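/- Let $C=\mathbb R/\mathbb Z$ be the circle of circumference $1$, let $(\ell_n)_{n\ge 1}$ be a decreasing sequence of positive numbers with $\sum_n \ell_n<\infty$, and fix $x\in C$. Given random centers $U_{n,t}\in C$ ($n\ge 1$, $t\ge 0$), let $I_{n,t}$ be the open arc of $C$ with center $U_{n,t}$ and length $\ell_n$ (the whole circle if $\ell_n>1$), let $E_t:=\limsup_n I_{n,t}$ be the set of points that lie in infinitely many of the arcs $I_{n,t}$, and let $T:=\{t\in[0,1] : x\in E_t\}$. (a) (Brownian model.) Suppose that the processes $(U_{n,t})_{t\ge 0}$, $n\ge 1$, are independent standard Brownian motions on $C$, each started from the uniform distribution (that is, each is the projection to $\mathbb R/\mathbb Z$ of a standard real Brownian motion started at an independent uniform point). Then $P(T\neq\emptyset)=1$. (b) (Poisson model with parameter $\alpha\ge 0$.) Let $C_{n,j}$ and $Y_{n,j}$ ($n,j\ge 1$) be independent random variables, with $C_{n,j}$ uniformly distributed on $C$ and $Y_{n,j}$ exponentially distributed with rate $\ell_n^{-\alpha}$. Put $T_{n,j}:=\sum_{k=1}^{j}Y_{n,k}$ for $j\ge 0$ and $U_{n,t}:=\sum_{j\ge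 1}C_{n,j}\mathbf 1_{[T_{n,j-1},T_{n,j})}(t)$. If $\sum_n \ell_n^{1-\alpha}<\infty$, then $P(T=\emptyset)=1$, while if $\sum_n \ell_n^{1-\alpha}=\infty$, then $P(T\neq\emptyset)=1$. -/

import Mathlib

open MeasureTheory ProbabilityTheory
open scoped NNReal

/-!
The circle `C` of circumference `1` is `UnitAddCircle = ℝ / ℤ`: its norm is the arclength distance
to the identity, and its `volume` is the uniform probability distribution. Sequences which are
usually indexed by `n ≥ 1` are indexed here by `n : ℕ`, starting from `0`.
-/

namespace CircleCovering

variable {Ω : Type*} [MeasurableSpace Ω]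

/-- The open arc of the circle with center `c` and length `l`. -/
def arc (c : UnitAddCircle) (l : ℝ) : Set UnitAddCircle :=
  Metric.ball c (l / 2)

/-- The random set `E_t = limsup_n I_{n,t}` of the points that lie in infinitely many of the arcs
`I_{n,t}`, where `I_{n,t}` has center `U n t ω` and length `ℓ n`. -/
noncomputable def coveredIO (ℓ : ℕ → ℝ) (U : ℕ → ℝ≥0 → Ω → UnitAddCircle) (t : ℝ≥0) (ω : Ω) :
    Set UnitAddCircle :=
  Filter.limsup (fun n => arc (U n t ω) (ℓ n)) Filter.atTop

/-- The random set `{t ∈ [0, 1] : x ∈ E_t}`. -/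
def coveringTimes (ℓ : ℕ → ℝ) (U : ℕ → ℝ≥0 → Ω → UnitAddCircle) (x : UnitAddCircle) (ω : Ω) :
    Set ℝ≥0 :=
  {t | t ∈ Set.Icc (0 : ℝ≥0) 1 ∧ x ∈ coveredIO ℓ U t ω}

/-- `U` is a standard Brownian motion on the circle, started from the uniform distribution:
the projection to `ℝ / ℤ` of a standard real Brownian motion (with a.s. continuous paths), started
at an independent, uniformly distributed point. -/
structure IsUniformCircleBrownian (U : ℝ≥0 → Ω → UnitAddCircle) (P : Measure Ω) : Prop where
  measurable : ∀ t, Measurable (U t)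
  exists_lift : ∃ (V : Ω → UnitAddCircle) (B : ℝ≥0 → Ω → ℝ),
    HasLaw V volume P ∧ IsBrownianReal B P ∧ IndepFun V (fun ω t => B t ω) P ∧
      ∀ᵐ ω ∂P, ∀ t, U t ω = V ω + (B t ω : UnitAddCircle)

/-- The Brownian model: the centers `(U n t)_{t ≥ 0}` are independent standard Brownian motions on
the circle, each started uniformly. -/
structure IsBrownianModel (U : ℕ → ℝ≥0 → Ω → UnitAddCircle) (P : Measure Ω) : Prop where
  brownian : ∀ n, IsUniformCircleBrownian (U n) P
  indep : iIndepFun (fun n ω t => U n t ω) P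

/-- The random variables that drive the Poisson model with parameter `α`: the positions `C n j` are
uniform on the circle, the waiting times `Y n j` are exponential with rate `(ℓ n) ^ (-α)`, and all
of these variables together are independent. -/
structure IsPoissonModel (ℓ : ℕ → ℝ) (α : ℝ) (C : ℕ → ℕ → Ω → UnitAddCircle)
    (Y : ℕ → ℕ → Ω → ℝ) (P : Measure Ω) : Prop where
  measurable_position : ∀ n j, Measurable (C n j)
  measurable_waiting : ∀ n j, Measurable (Y n j)
  law_position : ∀ n j, HasLaw (C n j) volume P
  law_waiting : ∀ n j, HasLaw (Y n j) (expMeasure (ℓ n ^ (-α))) P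
  indep_position : iIndepFun (fun p : ℕ × ℕ => C p.1 p.2) P
  indep_waiting : iIndepFun (fun p : ℕ × ℕ => Y p.1 p.2) P
  indep : IndepFun (fun ω (p : ℕ × ℕ) => C p.1 p.2 ω) (fun ω (p : ℕ × ℕ) => Y p.1 p.2 ω) P

/-- The update times of the arc number `n`: the sum of its first `j` waiting times. -/
def updateTime (Y : ℕ → ℕ → Ω → ℝ) (n j : ℕ) (ω : Ω) : ℝ :=
  ∑ k ∈ Finset.range j, Y n k ω

/-- The center at time `t` of the arc number `n` in the Poisson model: it is `C n j` for `t` between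
the `j`-th update time (included) and the next one (excluded). -/
noncomputable def poissonCenter (C : ℕ → ℕ → Ω → UnitAddCircle) (Y : ℕ → ℕ → Ω → ℝ)
    (n : ℕ) (t : ℝ≥0) (ω : Ω) : UnitAddCircle :=
  ∑' j : ℕ, Set.indicator (Set.Ico (updateTime Y n j ω) (updateTime Y n (j + 1) ω))
    (fun _ => C n j ω) (t : ℝ)

end CircleCovering

/-! Both nonemptiness claims reduce to one statement by Baire
(`coveringTimes_nonempty_of_frequently`): it suffices that for every rational interval of times,
infinitely many arcs `n` cover `x` on some open set of times meeting it. There are countably many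
intervals, so the second Borel–Cantelli lemma can be applied to each.

Brownian model: an increment of absolute value at least 1 makes the path run through the whole
circle. Hence an arc of any size covers `x` during the interval with probability at least some `c >
0` independent of `n`, and these probabilities cannot be summable.

Poisson model, with rate `r = ℓ n ^ (-α)`: about `r` centers are used in unit time and each lands
near `x` with probability of order `ℓ n`, so `x` is hit with probability of order at most `r * ℓ n =
ℓ n ^ (1 - α)`, up to an additive `ℓ n` for the initial center. If the series converges, the first
Borel–Cantelli lemma concludes. If it diverges, then `α > 0` and the rates tend to infinity;
Chebyshev puts a deterministic block of order `r` renewals inside the interval with probability at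
least 1/2, and independence of the centers gives a hit probability at least `f / (1 + f)`, with `f`
of order at least `ℓ n ^ (1 - α)`. -/

namespace CircleCovering

open Set Filter Topology
open scoped ENNReal

/-! ### Moments and Laplace transform of the exponential law -/

section Exponential

lemma expMeasure_eq_withDensity_restrict (r : ℝ) :
    expMeasure r =
      (volume.restrict (Ioi 0)).withDensity fun x => ENNReal.ofReal (r * Real.exp (-(r * x))) := by
  rw [← withDensity_indicator measurableSet_Ioi]
  refine withDensity_congr_ae ?_
  filter_upwards [compl_mem_ae_iff.2 (measure_singleton (μ := volume) (0 : ℝ))] with x hx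
  change exponentialPDF r x = _
  rcases lt_or_gt_of_ne (show x ≠ 0 from hx) with h | h
  · rw [exponentialPDF_of_neg h, indicator_of_notMem (by simpa using h.le)]
  · rw [exponentialPDF_of_nonneg h.le, indicator_of_mem (by simpa using h)]

lemma ae_pos_expMeasure (r : ℝ) : ∀ᵐ x ∂expMeasure r, 0 < x := by
  rw [expMeasure_eq_withDensity_restrict]
  exact (withDensity_absolutelyContinuous _ _).ae_le (ae_restrict_mem measurableSet_Ioi)

lemma integral_expMeasure {r : ℝ} (hr : 0 < r) (f : ℝ → ℝ) :
    ∫ x, f x ∂expMeasure r = ∫ x in Ioi 0, r * Real.exp (-(r * x)) * f x := by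
  rw [expMeasure_eq_withDensity_restrict, integral_withDensity_eq_integral_toReal_smul
    (by fun_prop) (by simp)]
  refine integral_congr_ae (ae_of_all _ fun x => ?_)
  simp only [smul_eq_mul]
  rw [ENNReal.toReal_ofReal (by positivity)]

lemma integral_pow_expMeasure {r : ℝ} (hr : 0 < r) (k : ℕ) :
    ∫ x, x ^ k ∂expMeasure r = k.factorial / r ^ k := by
  rw [integral_expMeasure hr]
  have h := Real.integral_rpow_mul_exp_neg_mul_Ioi (a := k + 1) (r := r) (by positivity) hr
  rw [Real.Gamma_nat_eq_factorial] at h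
  have h' : ∫ x in Ioi 0, r * Real.exp (-(r * x)) * x ^ k
      = r * ∫ x in Ioi 0, x ^ ((k + 1 : ℝ) - 1) * Real.exp (-(r * x)) := by
    rw [← integral_const_mul]
    refine setIntegral_congr_fun measurableSet_Ioi fun x _ => ?_
    simp only [add_sub_cancel_right, Real.rpow_natCast]
    ring
  rw [h', h]
  have : (1 / r) ^ ((k : ℝ) + 1) = (1 / r) ^ (k + 1) := by
    rw [← Real.rpow_natCast]; push_cast; rfl
  rw [this, pow_succ, one_div, inv_pow]
  field_simp

lemma integrable_pow_expMeasure {r : ℝ} (hr : 0 < r) (k : ℕ) :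
    Integrable (fun x => x ^ k) (expMeasure r) := by
  -- The integral of a non-integrable function is 0 by convention, so a nonzero value proves
  -- integrability.
  refine Integrable.of_integral_ne_zero ?_
  rw [integral_pow_expMeasure hr]
  positivity

lemma memLp_id_expMeasure {r : ℝ} (hr : 0 < r) : MemLp id 2 (expMeasure r) :=
  (memLp_two_iff_integrable_sq aestronglyMeasurable_id).2 (integrable_pow_expMeasure hr 2)

lemma variance_id_expMeasure {r : ℝ} (hr : 0 < r) :
    variance id (expMeasure r) = 1 / r ^ 2 := by
  have := isProbabilityMeasure_expMeasure hr
  rw [variance_eq_sub (memLp_id_expMeasure hr)]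
  have h1 := integral_pow_expMeasure hr 1
  have h2 := integral_pow_expMeasure hr 2
  simp only [pow_one] at h1
  simp only [Pi.pow_apply, id, h1, h2]
  norm_num [Nat.factorial]
  field_simp
  norm_num

lemma mgf_id_expMeasure {r t : ℝ} (hr : 0 < r) (ht : t < r) :
    mgf id (expMeasure r) t = r / (r - t) := by
  simp only [mgf, id]
  rw [integral_expMeasure hr]
  have h' : ∀ x : ℝ, r * Real.exp (-(r * x)) * Real.exp (t * x) =
      r * Real.exp ((t - r) * x) := fun x => by
    rw [mul_assoc, ← Real.exp_add]; ring_nf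
  simp_rw [h']
  rw [integral_const_mul, integral_exp_mul_Ioi (by linarith)]
  have : r - t ≠ 0 := by linarith
  have : t - r ≠ 0 := by linarith
  simp
  field_simp
  ring

end Exponential

/-! ### Deviations of sums of exponential waiting times -/

section Renewal

variable {Ω : Type*} [MeasurableSpace Ω] {P : Measure Ω} {Y : ℕ → Ω → ℝ} {r : ℝ}

lemma ae_pos_waiting (hlaw : ∀ j, HasLaw (Y j) (expMeasure r) P) : ∀ᵐ ω ∂P, ∀ j, 0 < Y j ω :=
  ae_all_iff.2 fun j => ((hlaw j).ae_iff (p := fun x => 0 < x) (by measurability)).2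
    (ae_pos_expMeasure r)

lemma measureReal_le_abs_sum_sub_le (hr : 0 < r) (hlaw : ∀ j, HasLaw (Y j) (expMeasure r) P)
    (hind : iIndepFun Y P) (k : ℕ) {c : ℝ} (hc : 0 < c) :
    P.real {ω | c ≤ |∑ j ∈ Finset.range k, Y j ω - k / r|} ≤ k / (r * c) ^ 2 := by
  have := hind.isProbabilityMeasure
  have hL : ∀ j, MemLp (Y j) 2 P := fun j => by
    have := memLp_id_expMeasure hr
    rw [← (hlaw j).map_eq] at this
    exact this.comp_of_map (hlaw j).aemeasurable
  have hE : ∀ j, P[Y j] = 1 / r := fun j => by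
    have := integral_pow_expMeasure hr 1
    rw [(hlaw j).integral_eq]
    simpa using this
  have hV : ∀ j, variance (Y j) P = 1 / r ^ 2 := fun j => by
    rw [(hlaw j).variance_eq, variance_id_expMeasure hr]
  have hsum : MemLp (∑ j ∈ Finset.range k, Y j) 2 P := memLp_finsetSum' _ fun j _ => hL j
  have hmean : P[∑ j ∈ Finset.range k, Y j] = k / r := by
    simp only [Finset.sum_apply]
    rw [integral_finsetSum _ fun j _ => (hL j).integrable one_le_two]
    simp [hE, div_eq_mul_inv]
  have hvar : variance (∑ j ∈ Finset.range k, Y j) P = k / r ^ 2 := by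
    rw [IndepFun.variance_sum (fun j _ => hL j) fun i _ j _ hij => hind.indepFun hij]
    simp [hV, div_eq_mul_inv]
  have h := meas_ge_le_variance_div_sq hsum hc
  rw [hmean, hvar] at h
  simp only [Finset.sum_apply] at h
  refine (ENNReal.toReal_le_of_le_ofReal (by positivity) h).trans_eq ?_
  rw [div_div, mul_pow]

/-- Chernoff bound with parameter `-1`. Its geometric decay in `k` makes the sum over all renewals
at most `e * (r + 1)`. -/
lemma measureReal_sum_le_one_le (hr : 0 < r) (hlaw : ∀ j, HasLaw (Y j) (expMeasure r) P)
    (hind : iIndepFun Y P) (k : ℕ) :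
    P.real {ω | ∑ j ∈ Finset.range k, Y j ω ≤ 1} ≤ Real.exp 1 * (r / (r + 1)) ^ k := by
  have := hind.isProbabilityMeasure
  have hmgf : ∀ j, mgf (Y j) P (-1) = r / (r + 1) := fun j => by
    rw [← mgf_id_map (hlaw j).aemeasurable, (hlaw j).map_eq, mgf_id_expMeasure hr (by linarith),
      sub_neg_eq_add]
  have hprod : mgf (∑ j ∈ Finset.range k, Y j) P (-1) = (r / (r + 1)) ^ k := by
    rw [hind.mgf_sum₀ fun j => (hlaw j).aemeasurable]
    simp [hmgf, div_pow]
  have hint : Integrable (fun ω => Real.exp (-1 * (∑ j ∈ Finset.range k, Y j) ω)) P := by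
    refine Integrable.of_integral_ne_zero ?_
    change mgf _ _ _ ≠ 0
    rw [hprod]
    positivity
  have h := measure_le_le_exp_mul_mgf 1 (by norm_num : (-1 : ℝ) ≤ 0) hint
  rw [hprod] at h
  simpa using h

end Renewal

/-! ### Independence and Borel–Cantelli -/

section Independence

variable {Ω : Type*} [MeasurableSpace Ω] {P : Measure Ω}

/-- Independence means that the joint law is a product measure, and currying turns the product over
`ι × κ` into the product over `ι` of the row laws. -/
lemma iIndepFun_rows {ι κ 𝓧 : Type*} [MeasurableSpace 𝓧] {X : ι × κ → Ω → 𝓧}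
    (hX : ∀ p, Measurable (X p)) (h : iIndepFun X P) :
    iIndepFun (fun i ω j => X (i, j) ω) P := by
  have := h.isProbabilityMeasure
  have : ∀ p, IsProbabilityMeasure (P.map (X p)) :=
    fun p => Measure.isProbabilityMeasure_map (hX p).aemeasurable
  have hrow : ∀ i, P.map (fun ω j => X (i, j) ω) =
      Measure.infinitePi fun j => P.map (X (i, j)) := fun i =>
    (iIndepFun_iff_map_fun_eq_infinitePi_map (fun j => hX (i, j))).1
      (h.precomp (g := fun j : κ => (i, j)) fun a b hab => (Prod.mk.inj hab).2)
  rw [iIndepFun_iff_map_fun_eq_infinitePi_map (by fun_prop)]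
  simp_rw [hrow]
  rw [← Measure.infinitePi_map_curry (fun i j => P.map (X (i, j))),
    ← (iIndepFun_iff_map_fun_eq_infinitePi_map hX).1 h, Measure.map_map (by fun_prop) (by fun_prop)]
  rfl

lemma iIndepSet_preimage {ι : Type*} {β : ι → Type*} [∀ i, MeasurableSpace (β i)]
    {f : ∀ i, Ω → β i} (hf : ∀ i, Measurable (f i)) (h : iIndepFun f P) {s : ∀ i, Set (β i)}
    (hs : ∀ i, MeasurableSet (s i)) : iIndepSet (fun i => f i ⁻¹' s i) P :=
  (iIndepSet_iff_meas_biInter fun i => hf i (hs i)).2 fun S =>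
    h.measure_inter_preimage_eq_mul S fun i _ => hs i

lemma iIndepSet_inter_preimage {ι : Type*} {β γ : ι → Type*} [∀ i, MeasurableSpace (β i)]
    [∀ i, MeasurableSpace (γ i)] {f : ∀ i, Ω → β i} {g : ∀ i, Ω → γ i}
    (hf : ∀ i, Measurable (f i)) (hg : ∀ i, Measurable (g i)) (hfi : iIndepFun f P)
    (hgi : iIndepFun g P) (hfg : IndepFun (fun ω i => f i ω) (fun ω i => g i ω) P)
    {s : ∀ i, Set (β i)} {t : ∀ i, Set (γ i)} (hs : ∀ i, MeasurableSet (s i))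
    (ht : ∀ i, MeasurableSet (t i)) : iIndepSet (fun i => f i ⁻¹' s i ∩ g i ⁻¹' t i) P := by
  refine (iIndepSet_iff_meas_biInter fun i => (hf i (hs i)).inter (hg i (ht i))).2 fun S => ?_
  have key : ∀ S : Finset ι, P (⋂ i ∈ S, (f i ⁻¹' s i ∩ g i ⁻¹' t i)) =
      P (⋂ i ∈ S, f i ⁻¹' s i) * P (⋂ i ∈ S, g i ⁻¹' t i) := fun S => by
    have h := hfg.measure_inter_preimage_eq_mul (⋂ i ∈ S, (fun x => x i) ⁻¹' s i)
      (⋂ i ∈ S, (fun x => x i) ⁻¹' t i)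
      (S.measurableSet_biInter fun i _ => measurable_pi_apply i (hs i))
      (S.measurableSet_biInter fun i _ => measurable_pi_apply i (ht i))
    simp only [preimage_iInter, ← preimage_comp] at h
    simp only [iInter_inter_distrib]
    exact h
  have hone : ∀ i, P (f i ⁻¹' s i ∩ g i ⁻¹' t i) = P (f i ⁻¹' s i) * P (g i ⁻¹' t i) := fun i => by
    simpa using key {i}
  rw [key, hfi.measure_inter_preimage_eq_mul S fun i _ => hs i,
    hgi.measure_inter_preimage_eq_mul S fun i _ => ht i, ← Finset.prod_mul_distrib]
  exact Finset.prod_congr rfl fun i _ => (hone i).symm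

lemma ae_frequently_mem_of_not_summable {s : ℕ → Set Ω} (hsm : ∀ n, MeasurableSet (s n))
    (hs : iIndepSet s P) (h : ¬ Summable fun n => P.real (s n)) :
    ∀ᵐ ω ∂P, ∃ᶠ n in atTop, ω ∈ s n := by
  have := hs.isProbabilityMeasure
  have htop : ∑' n, P (s n) = ∞ := by
    by_contra hne
    exact h (ENNReal.summable_toReal hne)
  have h1 := measure_limsup_eq_one hsm hs htop
  rw [← prob_compl_eq_zero_iff (MeasurableSet.measurableSet_limsup hsm)] at h1
  filter_upwards [compl_mem_ae_iff.2 h1] with ω hω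
  rw [compl_compl] at hω
  exact mem_limsup_iff_frequently_mem.1 hω

lemma div_one_add_le_measureReal_iUnion {C : ℕ → Ω → UnitAddCircle} (hC : ∀ j, Measurable (C j))
    (hlaw : ∀ j, HasLaw (C j) volume P) (hind : iIndepFun C P) (J : Finset ℕ)
    {s : Set UnitAddCircle} (hs : MeasurableSet s) :
    J.card * volume.real s / (1 + J.card * volume.real s) ≤ P.real (⋃ j ∈ J, C j ⁻¹' s) := by
  have := hind.isProbabilityMeasure
  have hmeas : MeasurableSet (⋃ j ∈ J, C j ⁻¹' s) := J.measurableSet_biUnion fun j _ => hC j hs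
  have hprob : IsProbabilityMeasure (volume : Measure UnitAddCircle) := by
    rw [← (hlaw 0).map_eq]
    exact Measure.isProbabilityMeasure_map (hC 0).aemeasurable
  set p := volume.real s
  have hp0 : 0 ≤ p := measureReal_nonneg
  have hp1 : p ≤ 1 := measureReal_le_one
  have hcompl : P.real (⋃ j ∈ J, C j ⁻¹' s)ᶜ = (1 - p) ^ J.card := by
    simp only [compl_iUnion, ← preimage_compl]
    rw [measureReal_def, hind.measure_inter_preimage_eq_mul J (sets := fun _ => sᶜ)
      fun _ _ => hs.compl, ENNReal.toReal_prod, Finset.prod_congr rfl (g := fun _ => 1 - p),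
      Finset.prod_const]
    intro j _
    rw [← Measure.map_apply (hC j) hs.compl, (hlaw j).map_eq, ← measureReal_def,
      probReal_compl_eq_one_sub hs]
  rw [probReal_compl_eq_one_sub hmeas] at hcompl
  rw [show P.real (⋃ j ∈ J, C j ⁻¹' s) = 1 - (1 - p) ^ J.card by linarith,
    div_le_iff₀ (by positivity)]
  -- Bernoulli: `1 + N p ≤ (1 + p) ^ N`, and `(1 - p) (1 + p) ≤ 1`.
  have hb := one_add_mul_le_pow (show (-2 : ℝ) ≤ p by linarith) J.card
  have h1 : (1 - p) ^ J.card * (1 + J.card * p) ≤ 1 := by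
    calc (1 - p) ^ J.card * (1 + J.card * p) ≤ (1 - p) ^ J.card * (1 + p) ^ J.card :=
          mul_le_mul_of_nonneg_left hb (pow_nonneg (by linarith) _)
      _ = ((1 - p) * (1 + p)) ^ J.card := (mul_pow _ _ _).symm
      _ ≤ 1 := pow_le_one₀ (by nlinarith) (by nlinarith)
  linarith

end Independence

/-! ### Summability, arc lengths and Baire category -/

lemma Summable.of_div_one_add {f : ℕ → ℝ} (hf : ∀ n, 0 ≤ f n)
    (h : Summable fun n => f n / (1 + f n)) : Summable f := by
  -- Once `f / (1 + f) < 1 / 2`, one has `f < 1`, hence `f ≤ 2 * (f / (1 + f))`.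
  have hlim := h.tendsto_atTop_zero.eventually (gt_mem_nhds (show (0 : ℝ) < 1 / 2 by norm_num))
  refine Summable.of_norm_bounded_eventually_nat (h.mul_left 2) ?_
  filter_upwards [hlim] with n hn
  have := hf n
  rw [div_lt_iff₀ (by positivity)] at hn
  rw [Real.norm_of_nonneg this, ← mul_div_assoc, le_div_iff₀ (by positivity)]
  nlinarith

lemma measureReal_ball_le (c : UnitAddCircle) (r : ℝ) (hr : 0 ≤ r) :
    volume.real (Metric.ball c r) ≤ 2 * r := by
  refine ENNReal.toReal_le_of_le_ofReal (by positivity) ?_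
  refine (measure_mono Metric.ball_subset_closedBall).trans ?_
  rw [AddCircle.volume_closedBall]
  exact ENNReal.ofReal_le_ofReal (min_le_right _ _)

lemma min_le_measureReal_ball (c : UnitAddCircle) {r : ℝ} (hr : 0 < r) :
    min 1 r ≤ volume.real (Metric.ball c r) := by
  have h : volume (Metric.closedBall c (r / 2)) ≤ volume (Metric.ball c r) :=
    measure_mono (Metric.closedBall_subset_ball (by linarith))
  rw [AddCircle.volume_closedBall, mul_div_cancel₀ r two_ne_zero] at h
  exact (ENNReal.ofReal_le_iff_le_toReal (measure_ne_top _ _)).1 h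

/-- If every interval of times contains, for infinitely many `n`, a time interior to `S n`, then
the times which lie in infinitely many of the sets `S n` are dense, by Baire's theorem. -/
lemma dense_limsup_of_frequently {S : ℕ → Set ℝ≥0}
    (h : ∀ p q : ℚ, 0 ≤ p → p < q →
      ∃ᶠ n in atTop, (interior (S n) ∩ {t | (p : ℝ) < t ∧ (t : ℝ) < q}).Nonempty) :
    Dense {t | ∃ᶠ n in atTop, t ∈ S n} := by
  have hd := dense_iInter_of_isOpen_nat (f := fun N => ⋃ n ≥ N, interior (S n))
    (fun N => isOpen_biUnion fun n _ => isOpen_interior) fun N => ?_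
  · refine hd.mono fun t ht => frequently_atTop.2 fun N => ?_
    obtain ⟨n, hn, htn⟩ := mem_iUnion₂.1 (mem_iInter.1 ht N)
    exact ⟨n, hn, interior_subset htn⟩
  · refine dense_iff_inter_open.2 fun V hV ⟨t, ht⟩ => ?_
    obtain ⟨u, htu, hu⟩ := exists_Ico_subset_of_mem_nhds (hV.mem_nhds ht) ⟨t + 1, by simp⟩
    obtain ⟨p, hp1, hp2⟩ := exists_rat_btwn (NNReal.coe_lt_coe.2 htu)
    obtain ⟨q, hq1, hq2⟩ := exists_rat_btwn hp2
    have hp0 : (0 : ℝ) ≤ p := t.2.trans hp1.le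
    obtain ⟨n, hn, s, hs, hs1, hs2⟩ := frequently_atTop.1
      (h p q (by exact_mod_cast hp0) (by exact_mod_cast hq1)) N
    refine ⟨s, hu ⟨?_, ?_⟩, mem_iUnion₂.2 ⟨n, hn, hs⟩⟩
    · exact NNReal.coe_le_coe.1 (hp1.trans hs1).le
    · exact NNReal.coe_lt_coe.1 (hs2.trans hq2)

lemma coveringTimes_nonempty_of_frequently {Ω : Type*} {ℓ : ℕ → ℝ}
    {U : ℕ → ℝ≥0 → Ω → UnitAddCircle} {x : UnitAddCircle} {ω : Ω}
    (h : ∀ p q : ℚ, 0 ≤ p → p < q → ∃ᶠ n in atTop,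
      (interior {t | x ∈ arc (U n t ω) (ℓ n)} ∩ {t | (p : ℝ) < t ∧ (t : ℝ) < q}).Nonempty) :
    (coveringTimes ℓ U x ω).Nonempty := by
  obtain ⟨t, ht, h0, h1⟩ := (dense_limsup_of_frequently h).exists_mem_open isOpen_Ioo
    (nonempty_Ioo.2 (zero_lt_one (α := ℝ≥0)))
  exact ⟨t, ⟨h0.le, h1.le⟩, mem_limsup_iff_frequently_mem.2 ht⟩

/-! ### The Brownian model -/

section Brownian

/-- The paths that visit `s` at some time `t` with `p < t < q` in a fixed dense sequence. -/
def visits (p q : ℚ) (s : Set UnitAddCircle) : Set (ℝ≥0 → UnitAddCircle) :=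
  ⋃ (k : ℕ) (_ : (p : ℝ) < TopologicalSpace.denseSeq ℝ≥0 k ∧
    (TopologicalSpace.denseSeq ℝ≥0 k : ℝ) < q), {u | u (TopologicalSpace.denseSeq ℝ≥0 k) ∈ s}

lemma measurableSet_visits (p q : ℚ) {s : Set UnitAddCircle} (hs : MeasurableSet s) :
    MeasurableSet (visits p q s) :=
  MeasurableSet.iUnion fun _ => MeasurableSet.iUnion fun _ => measurable_pi_apply _ hs

/-- Using countably many times makes `visits` measurable for the product σ-algebra. Nothing is lost
for continuous paths: the times spent in an open set form an open set. -/
lemma mem_visits {p q : ℚ} {s : Set UnitAddCircle} (hs : IsOpen s) {u : ℝ≥0 → UnitAddCircle}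
    (hu : Continuous u) {t : ℝ≥0} (hpt : (p : ℝ) < t) (htq : (t : ℝ) < q) (ht : u t ∈ s) :
    u ∈ visits p q s := by
  have hopen : IsOpen (u ⁻¹' s ∩ ({t : ℝ≥0 | (p : ℝ) < t} ∩ {t : ℝ≥0 | (t : ℝ) < q})) :=
    (hs.preimage hu).inter ((isOpen_lt continuous_const NNReal.continuous_coe).inter
      (isOpen_lt NNReal.continuous_coe continuous_const))
  obtain ⟨k, hk1, hk2⟩ := (TopologicalSpace.denseRange_denseSeq ℝ≥0).exists_mem_open hopen
    ⟨t, ht, hpt, htq⟩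
  exact mem_iUnion₂.2 ⟨k, hk2, hk1⟩

/-- By the intermediate value theorem the path covers an interval of length 1, which projects onto
the circle. -/
lemma exists_coe_eq_of_one_le_abs_sub {b : ℝ≥0 → ℝ} (hb : Continuous b) {s t : ℝ≥0} (hst : s ≤ t)
    (h : 1 ≤ |b t - b s|) (x : UnitAddCircle) : ∃ u ∈ Icc s t, (b u : UnitAddCircle) = x := by
  have hx : x ∈ ((↑) : ℝ → UnitAddCircle) '' Icc (min (b s) (b t)) (min (b s) (b t) + 1) := by
    rw [AddCircle.coe_image_Icc_eq]
    trivial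
  obtain ⟨y, hy, rfl⟩ := hx
  have hy' : y ∈ uIcc (b s) (b t) := by
    refine ⟨hy.1, hy.2.trans ?_⟩
    rw [← max_sub_min_eq_abs'] at h
    rw [max_comm (b t), min_comm (b t)] at h
    change _ ≤ max (b s) (b t)
    linarith
  obtain ⟨u, hu, rfl⟩ := intermediate_value_uIcc (hb.continuousOn (s := uIcc s t)) hy'
  exact ⟨u, by rwa [uIcc_of_le hst] at hu, rfl⟩

variable {Ω : Type*} [MeasurableSpace Ω] {P : Measure Ω}

lemma IsUniformCircleBrownian.ae_continuous {U : ℝ≥0 → Ω → UnitAddCircle}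
    (h : IsUniformCircleBrownian U P) : ∀ᵐ ω ∂P, Continuous fun t => U t ω := by
  obtain ⟨V, B, -, hB, -, hU⟩ := h.exists_lift
  filter_upwards [hB.cont, hU] with ω hcont hω
  simp_rw [hω]
  exact continuous_const.add ((AddCircle.continuous_mk' 1).comp hcont)

/-- The constant is the probability that the increment over some `[a, b]` inside `(p, q)` is at
least 1 in absolute value; it depends neither on `s` nor on the motion. -/
lemma exists_le_measureReal_visits {p q : ℚ} (hp : 0 ≤ p) (hpq : p < q) :
    ∃ c : ℝ, 0 < c ∧ ∀ (P : Measure Ω) [IsProbabilityMeasure P] (U : ℝ≥0 → Ω → UnitAddCircle),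
      IsUniformCircleBrownian U P → ∀ (s : Set UnitAddCircle), IsOpen s → s.Nonempty →
        c ≤ P.real {ω | (fun t => U t ω) ∈ visits p q s} := by
  obtain ⟨a, hpa, haq⟩ := exists_between hpq
  obtain ⟨b, hab, hbq⟩ := exists_between haq
  have ha : (0 : ℝ) ≤ a := by exact_mod_cast hp.trans hpa.le
  have hb : (0 : ℝ) ≤ b := by exact_mod_cast (hp.trans hpa.le).trans hab.le
  set a' : ℝ≥0 := ⟨a, ha⟩
  set b' : ℝ≥0 := ⟨b, hb⟩
  have hab' : a' < b' := NNReal.coe_lt_coe.1 (show (a : ℝ) < b by exact_mod_cast hab)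
  have hv : nndist (b' : ℝ) (a' : ℝ) ≠ 0 := by
    rw [Ne, nndist_eq_zero]
    exact fun h => hab'.ne' (NNReal.coe_injective h)
  have hms : MeasurableSet {y : ℝ | 1 ≤ |y|} := measurableSet_le measurable_const (by fun_prop)
  refine ⟨(gaussianReal 0 (nndist (b' : ℝ) (a' : ℝ))).real {y | 1 ≤ |y|}, ?_, ?_⟩
  · refine ENNReal.toReal_pos (fun h0 => ?_) (measure_ne_top _ _)
    -- Lebesgue measure is absolutely continuous with respect to a nondegenerate Gaussian.
    have h1 := gaussianReal_absolutelyContinuous' 0 hv h0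
    have h2 : volume (Ici (1 : ℝ)) ≤ volume {y : ℝ | 1 ≤ |y|} :=
      measure_mono fun y (hy : 1 ≤ y) => hy.trans (le_abs_self y)
    rw [h1, Real.volume_Ici] at h2
    simp at h2
  · intro P _ U hU s hs ⟨x, hx⟩
    have hUc := hU.ae_continuous
    obtain ⟨V, B, -, hB, -, hUB⟩ := hU.exists_lift
    have hlaw : HasLaw (B b' - B a') (gaussianReal 0 (nndist (b' : ℝ) (a' : ℝ))) P :=
      hB.hasLaw_sub b' a'
    rw [← hlaw.measureReal_eq hms]
    refine ENNReal.toReal_mono (measure_ne_top _ _) (measure_mono_ae ?_)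
    filter_upwards [hB.cont, hUB, hUc] with ω hcont hω hcontU hmem
    obtain ⟨u, ⟨hau, hub⟩, hxu⟩ :=
      exists_coe_eq_of_one_le_abs_sub hcont hab'.le (show 1 ≤ |B b' ω - B a' ω| from hmem) (x - V ω)
    refine mem_visits hs hcontU (t := u) ?_ ?_ ?_
    · exact (show (p : ℝ) < a by exact_mod_cast hpa).trans_le (NNReal.coe_le_coe.2 hau)
    · exact (NNReal.coe_le_coe.2 hub).trans_lt (show (b : ℝ) < q by exact_mod_cast hbq)
    · rw [hω, hxu, add_sub_cancel]
      exact hx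

theorem IsBrownianModel.ae_coveringTimes_nonempty [IsProbabilityMeasure P]
    {U : ℕ → ℝ≥0 → Ω → UnitAddCircle} (hU : IsBrownianModel U P) {ℓ : ℕ → ℝ} (hpos : ∀ n, 0 < ℓ n)
    (x : UnitAddCircle) : ∀ᵐ ω ∂P, (coveringTimes ℓ U x ω).Nonempty := by
  have hball : ∀ n, IsOpen (Metric.ball x (ℓ n / 2)) := fun n => Metric.isOpen_ball
  have hmeas : ∀ n, Measurable fun ω t => U n t ω := fun n =>
    measurable_pi_lambda _ (hU.brownian n).measurable
  have key : ∀ p q : ℚ, ∀ᵐ ω ∂P, 0 ≤ p → p < q →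
      ∃ᶠ n in atTop, (fun t => U n t ω) ∈ visits p q (Metric.ball x (ℓ n / 2)) := by
    intro p q
    by_cases hpq : 0 ≤ p ∧ p < q
    swap
    · exact ae_of_all _ fun ω h1 h2 => absurd ⟨h1, h2⟩ hpq
    have hms := fun n => measurableSet_visits p q (hball n).measurableSet
    have := ae_frequently_mem_of_not_summable (fun n => hmeas n (hms n))
      (iIndepSet_preimage hmeas hU.indep hms) fun hs => ?_
    · filter_upwards [this] with ω hω _ _ using hω
    · obtain ⟨c, hc, hle⟩ := exists_le_measureReal_visits (Ω := Ω) hpq.1 hpq.2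
      obtain ⟨n, hn⟩ := (hs.tendsto_atTop_zero.eventually (gt_mem_nhds hc)).exists
      exact hn.not_ge (hle P (U n) (hU.brownian n) _ (hball n)
        ⟨x, Metric.mem_ball_self (half_pos (hpos n))⟩)
  filter_upwards [ae_all_iff.2 fun n => (hU.brownian n).ae_continuous,
    ae_all_iff.2 fun p => ae_all_iff.2 (key p)] with ω hcont hω
  refine coveringTimes_nonempty_of_frequently fun p q hp hpq => (hω p q hp hpq).mono fun n hn => ?_
  obtain ⟨k, hk, hmem⟩ := mem_iUnion₂.1 hn
  refine ⟨TopologicalSpace.denseSeq ℝ≥0 k, ?_, hk⟩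
  have hopen : IsOpen {t | x ∈ arc (U n t ω) (ℓ n)} := by
    simp only [arc, Metric.mem_ball']
    exact isOpen_lt ((hcont n).dist continuous_const) continuous_const
  rw [hopen.interior_eq]
  exact Metric.mem_ball_comm.1 hmem

end Brownian

lemma measurableSet_lt_and_lt {β : Type*} [MeasurableSpace β] {f g : β → ℝ} (hf : Measurable f)
    (hg : Measurable g) (p q : ℝ) : MeasurableSet {b | p < f b ∧ g b < q} :=
  (measurableSet_lt measurable_const hf).inter (measurableSet_lt hg measurable_const)

/-! ### The Poisson model: paths and renewal events -/

section Poisson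

variable {Ω : Type*} {ℓ : ℕ → ℝ} {C : ℕ → ℕ → Ω → UnitAddCircle} {Y : ℕ → ℕ → Ω → ℝ}

lemma monotone_updateTime {n : ℕ} {ω : Ω} (hY : ∀ k, 0 ≤ Y n k ω) :
    Monotone fun j => updateTime Y n j ω :=
  monotone_nat_of_le_succ fun j => by
    simp only [updateTime, Finset.sum_range_succ]
    linarith [hY j]

lemma poissonCenter_eq {n : ℕ} {ω : Ω} (hY : ∀ k, 0 ≤ Y n k ω) {j : ℕ} {t : ℝ≥0}
    (ht : (t : ℝ) ∈ Ico (updateTime Y n j ω) (updateTime Y n (j + 1) ω)) :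
    poissonCenter C Y n t ω = C n j ω := by
  rw [poissonCenter, tsum_eq_single j, indicator_of_mem ht]
  intro i hi
  refine indicator_of_notMem (fun hti => hi ?_) _
  have hmono := monotone_updateTime hY
  refine le_antisymm (not_lt.1 fun h => ?_) (not_lt.1 fun h => ?_)
  · exact (ht.2.trans_le (hmono (Nat.succ_le_of_lt h))).not_ge hti.1
  · exact (hti.2.trans_le (hmono (Nat.succ_le_of_lt h))).not_ge ht.1

lemma exists_mem_Ico_updateTime {n : ℕ} {ω : Ω} (h : ∃ j, 1 < updateTime Y n j ω) {t : ℝ≥0}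
    (ht : t ≤ 1) :
    ∃ j, (t : ℝ) ∈ Ico (updateTime Y n j ω) (updateTime Y n (j + 1) ω) := by
  classical
  have h' : ∃ j, (t : ℝ) < updateTime Y n j ω :=
    h.imp fun j hj => (show (t : ℝ) ≤ 1 by exact_mod_cast ht).trans_lt hj
  obtain ⟨j, hj⟩ : ∃ j, Nat.find h' = j + 1 := by
    refine Nat.exists_eq_succ_of_ne_zero fun h0 => ?_
    have := Nat.find_spec h'
    rw [h0, updateTime, Finset.sum_range_zero] at this
    exact this.not_ge t.2
  exact ⟨j, not_lt.1 (Nat.find_min h' (by omega)), hj ▸ Nat.find_spec h'⟩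

/-- The event that arc number `n` is renewed with index in `[k n, m n)` at a center in `s n`, while
the renewals with these indices take place between the times `p` and `q`. -/
def renewalEvent (C : ℕ → ℕ → Ω → UnitAddCircle) (Y : ℕ → ℕ → Ω → ℝ) (k m : ℕ → ℕ) (p q : ℝ)
    (s : ℕ → Set UnitAddCircle) (n : ℕ) : Set Ω :=
  {ω | p < updateTime Y n (k n) ω ∧ updateTime Y n (m n) ω < q} ∩
    ⋃ j ∈ Finset.Ico (k n) (m n), C n j ⁻¹' s n

/-- The arc stands still between the update times `j` and `j + 1`, and both lie in `(p, q)` because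
`k n ≤ j` and `j + 1 ≤ m n`. -/
lemma nonempty_interior_of_mem_renewalEvent {k m : ℕ → ℕ} {p q : ℝ} {x : UnitAddCircle}
    {n : ℕ} {ω : Ω} (hY : ∀ k, 0 < Y n k ω)
    (hω : ω ∈ renewalEvent C Y k m p q (fun n => Metric.ball x (ℓ n / 2)) n) :
    (interior {t | x ∈ arc (poissonCenter C Y n t ω) (ℓ n)} ∩
      {t : ℝ≥0 | p < t ∧ (t : ℝ) < q}).Nonempty := by
  obtain ⟨⟨hp, hq⟩, hC⟩ := hω
  obtain ⟨j, hj, hx⟩ := mem_iUnion₂.1 hC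
  obtain ⟨hkj, hjm⟩ := Finset.mem_Ico.1 hj
  have hmono := monotone_updateTime fun k => (hY k).le
  have hlt : updateTime Y n j ω < updateTime Y n (j + 1) ω := by
    rw [updateTime, updateTime, Finset.sum_range_succ]
    linarith [hY j]
  have h0 : 0 ≤ updateTime Y n j ω := Finset.sum_nonneg fun k _ => (hY k).le
  obtain ⟨t, hjt, htj⟩ := exists_between hlt
  have hopen : IsOpen ({t : ℝ≥0 | updateTime Y n j ω < t} ∩
      {t : ℝ≥0 | (t : ℝ) < updateTime Y n (j + 1) ω}) :=
    (isOpen_lt continuous_const NNReal.continuous_coe).inter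
      (isOpen_lt NNReal.continuous_coe continuous_const)
  refine ⟨⟨t, h0.trans hjt.le⟩, interior_maximal (fun u hu => ?_) hopen ⟨hjt, htj⟩,
    hp.trans_le ((hmono hkj).trans hjt.le), htj.trans_le ((hmono hjm).trans hq.le)⟩
  rw [mem_ofPred_eq, poissonCenter_eq (fun k => (hY k).le) ⟨hu.1.le, hu.2⟩]
  exact Metric.mem_ball_comm.1 hx

variable [MeasurableSpace Ω] {P : Measure Ω} {α : ℝ}

/-! ### The Poisson model: the convergent case -/

namespace IsPoissonModel

lemma indep_waiting_row (h : IsPoissonModel ℓ α C Y P) (n : ℕ) : iIndepFun (Y n) P :=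
  h.indep_waiting.precomp (g := fun j : ℕ => (n, j)) fun _ _ hab => (Prod.mk.inj hab).2

lemma indep_position_row (h : IsPoissonModel ℓ α C Y P) (n : ℕ) : iIndepFun (C n) P :=
  h.indep_position.precomp (g := fun j : ℕ => (n, j)) fun _ _ hab => (Prod.mk.inj hab).2

lemma measurable_updateTime (h : IsPoissonModel ℓ α C Y P) (n j : ℕ) :
    Measurable (updateTime Y n j) :=
  Finset.measurable_fun_sum _ fun k _ => h.measurable_waiting n k

lemma ae_waiting_pos (h : IsPoissonModel ℓ α C Y P) : ∀ᵐ ω ∂P, ∀ n k, 0 < Y n k ω :=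
  ae_all_iff.2 fun n => ae_pos_waiting (h.law_waiting n)

lemma measure_updateTime_le_one_le [IsProbabilityMeasure P] (h : IsPoissonModel ℓ α C Y P)
    (hpos : ∀ n, 0 < ℓ n) (n j : ℕ) :
    P {ω | updateTime Y n j ω ≤ 1} ≤
      ENNReal.ofReal (Real.exp 1 * (ℓ n ^ (-α) / (ℓ n ^ (-α) + 1)) ^ j) := by
  rw [← ofReal_measureReal (measure_ne_top _ _)]
  exact ENNReal.ofReal_le_ofReal (measureReal_sum_le_one_le (Real.rpow_pos_of_pos (hpos n) _)
    (h.law_waiting n) (h.indep_waiting_row n) j)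

lemma measure_updateTime_le_one_inter_le [IsProbabilityMeasure P] (h : IsPoissonModel ℓ α C Y P)
    (hpos : ∀ n, 0 < ℓ n) (x : UnitAddCircle) (n j : ℕ) :
    P ({ω | updateTime Y n j ω ≤ 1} ∩ C n j ⁻¹' Metric.ball x (ℓ n / 2)) ≤
      ENNReal.ofReal (Real.exp 1 * ℓ n * (ℓ n ^ (-α) / (ℓ n ^ (-α) + 1)) ^ j) := by
  have hind : IndepFun (updateTime Y n j) (C n j) P :=
    (h.indep.comp (φ := fun c : ℕ × ℕ → UnitAddCircle => c (n, j))
      (ψ := fun y : ℕ × ℕ → ℝ => ∑ k ∈ Finset.range j, y (n, k)) (by fun_prop)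
      (by fun_prop)).symm.congr (ae_of_all _ fun _ => rfl) (ae_of_all _ fun _ => rfl)
  have hr := Real.rpow_pos_of_pos (hpos n) (-α)
  have hball : P (C n j ⁻¹' Metric.ball x (ℓ n / 2)) ≤ ENNReal.ofReal (ℓ n) := by
    rw [← Measure.map_apply (h.measurable_position n j) Metric.isOpen_ball.measurableSet,
      (h.law_position n j).map_eq, ← ofReal_measureReal (measure_ne_top _ _)]
    refine ENNReal.ofReal_le_ofReal ((measureReal_ball_le x _ (half_pos (hpos n)).le).trans_eq ?_)
    ring
  have hmul := hind.measure_inter_preimage_eq_mul (Iic 1) (Metric.ball x (ℓ n / 2))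
    measurableSet_Iic Metric.isOpen_ball.measurableSet
  refine hmul.trans_le ((mul_le_mul' (h.measure_updateTime_le_one_le hpos n j) hball).trans_eq ?_)
  rw [← ENNReal.ofReal_mul (by positivity)]
  ring_nf

lemma hasSum_pow_div_add_one {r : ℝ} (hr : 0 < r) :
    HasSum (fun j : ℕ => (r / (r + 1)) ^ j) (r + 1) := by
  have h := hasSum_geometric_of_lt_one (r := r / (r + 1)) (by positivity)
    ((div_lt_one (by positivity)).2 (by linarith))
  convert h using 1
  field_simp
  ring

/-- Rules out update times accumulating by time 1, after which `poissonCenter` would be an empty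
sum, with value 0. -/
lemma ae_exists_one_lt_updateTime [IsProbabilityMeasure P] (h : IsPoissonModel ℓ α C Y P)
    (hpos : ∀ n, 0 < ℓ n) : ∀ᵐ ω ∂P, ∀ n, ∃ j, 1 < updateTime Y n j ω := by
  refine ae_all_iff.2 fun n => ?_
  have hs := (hasSum_pow_div_add_one (Real.rpow_pos_of_pos (hpos n) (-α))).summable.mul_left
    (Real.exp 1)
  have hne : ∑' j, P {ω | updateTime Y n j ω ≤ 1} ≠ ∞ :=
    ne_top_of_le_ne_top hs.tsum_ofReal_ne_top
      (ENNReal.tsum_le_tsum fun j => h.measure_updateTime_le_one_le hpos n j)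
  filter_upwards [ae_eventually_notMem hne] with ω hω
  obtain ⟨j, hj⟩ := hω.exists
  exact ⟨j, not_le.1 hj⟩

theorem ae_coveringTimes_eq_empty [IsProbabilityMeasure P] (h : IsPoissonModel ℓ α C Y P)
    (hpos : ∀ n, 0 < ℓ n) (hsum : Summable ℓ) (hα : Summable fun n => ℓ n ^ (1 - α))
    (x : UnitAddCircle) : ∀ᵐ ω ∂P, coveringTimes ℓ (poissonCenter C Y) x ω = ∅ := by
  -- Union bound over the centers adopted by time 1: the geometric series gives `e * ℓ n * (r + 1)`
  -- with `r = ℓ n ^ (-α)`.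
  have hle : ∀ n, P (⋃ j, ({ω | updateTime Y n j ω ≤ 1} ∩ C n j ⁻¹' Metric.ball x (ℓ n / 2))) ≤
      ENNReal.ofReal (Real.exp 1 * (ℓ n ^ (1 - α) + ℓ n)) := fun n => by
    have hr := Real.rpow_pos_of_pos (hpos n) (-α)
    have hs := (hasSum_pow_div_add_one hr).mul_left (Real.exp 1 * ℓ n)
    refine (measure_iUnion_le _).trans ((ENNReal.tsum_le_tsum fun j =>
      h.measure_updateTime_le_one_inter_le hpos x n j).trans_eq ?_)
    have := hpos n
    rw [← ENNReal.ofReal_tsum_of_nonneg (fun j => by positivity) hs.summable, hs.tsum_eq,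
      sub_eq_add_neg, Real.rpow_add (hpos n), Real.rpow_one]
    ring_nf
  have hne := ne_top_of_le_ne_top ((hα.add hsum).mul_left (Real.exp 1)).tsum_ofReal_ne_top
    (ENNReal.tsum_le_tsum hle)
  filter_upwards [h.ae_waiting_pos, h.ae_exists_one_lt_updateTime hpos, ae_eventually_notMem hne]
    with ω hY hT hω
  refine eq_empty_of_forall_notMem fun t ⟨ht, hx⟩ => ?_
  obtain ⟨n, hn, hnot⟩ := ((mem_limsup_iff_frequently_mem.1 hx).and_eventually hω).exists
  obtain ⟨j, hj⟩ := exists_mem_Ico_updateTime (hT n) ht.2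
  rw [poissonCenter_eq (fun k => (hY n k).le) hj] at hn
  exact hnot (mem_iUnion.2 ⟨j, hj.1.trans (by exact_mod_cast ht.2), Metric.mem_ball_comm.1 hn⟩)

end IsPoissonModel

/-- The means `k / r` and `m / r` are at least `δ` inside the relevant ends of `(p, q)`. By
Chebyshev each sum deviates by `δ` with probability at most `q / (r * δ ^ 2) ≤ 1 / 4`. -/
lemma half_le_measureReal_lt_sum_and_sum_lt {Y : ℕ → Ω → ℝ} {r p q δ : ℝ} (hr : 0 < r)
    (hδ : 0 < δ) (hlaw : ∀ j, HasLaw (Y j) (expMeasure r) P) (hY : ∀ j, Measurable (Y j))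
    (hind : iIndepFun Y P) {k m : ℕ} (hkm : k ≤ m) (hk : r * (p + δ) ≤ k) (hm : m ≤ r * (q - δ))
    (hrδ : 4 * q ≤ r * δ ^ 2) :
    1 / 2 ≤ P.real {ω | p < ∑ j ∈ Finset.range k, Y j ω ∧ ∑ j ∈ Finset.range m, Y j ω < q} := by
  have := hind.isProbabilityMeasure
  have hms : MeasurableSet
      {ω | p < ∑ j ∈ Finset.range k, Y j ω ∧ ∑ j ∈ Finset.range m, Y j ω < q} :=
    measurableSet_lt_and_lt (by fun_prop) (by fun_prop) p q
  have hquarter : ∀ i : ℕ, i ≤ m →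
      P.real {ω | δ ≤ |∑ j ∈ Finset.range i, Y j ω - i / r|} ≤ 1 / 4 := fun i hi => by
    refine (measureReal_le_abs_sum_sub_le hr hlaw hind i hδ).trans ?_
    have hi' : (i : ℝ) ≤ m := by exact_mod_cast hi
    rw [div_le_iff₀ (by positivity)]
    nlinarith [mul_le_mul_of_nonneg_left hrδ hr.le, mul_pos hr hδ]
  have hsub : {ω | p < ∑ j ∈ Finset.range k, Y j ω ∧ ∑ j ∈ Finset.range m, Y j ω < q}ᶜ ⊆
      {ω | δ ≤ |∑ j ∈ Finset.range k, Y j ω - k / r|} ∪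
        {ω | δ ≤ |∑ j ∈ Finset.range m, Y j ω - m / r|} := by
    intro ω hω
    have hk' : p + δ ≤ k / r := (le_div_iff₀ hr).2 (by linarith)
    have hm' : m / r ≤ q - δ := (div_le_iff₀ hr).2 (by linarith)
    simp only [mem_compl_iff, mem_ofPred_eq, not_and_or, not_lt] at hω
    refine hω.imp (fun h => ?_) fun h => ?_
    · exact (show δ ≤ -(∑ j ∈ Finset.range k, Y j ω - k / r) by linarith).trans (neg_le_abs _)
    · exact (show δ ≤ ∑ j ∈ Finset.range m, Y j ω - m / r by linarith).trans (le_abs_self _)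
  have h1 := (measureReal_mono (μ := P) hsub).trans (measureReal_union_le _ _)
  rw [probReal_compl_eq_one_sub hms] at h1
  linarith [hquarter k hkm, hquarter m le_rfl]

/-! ### The Poisson model: the divergent case -/

namespace IsPoissonModel

lemma tendsto_rate_atTop (hpos : ∀ n, 0 < ℓ n) (hsum : Summable ℓ) (hα : 0 < α) :
    Tendsto (fun n => ℓ n ^ (-α)) atTop atTop := by
  have h0 : Tendsto (fun n => ℓ n ^ α) atTop (𝓝[>] 0) := by
    refine tendsto_nhdsWithin_iff.2 ⟨?_,
      Eventually.of_forall fun n => Real.rpow_pos_of_pos (hpos n) _⟩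
    have := hsum.tendsto_atTop_zero.rpow_const (p := α) (Or.inr hα.le)
    rwa [Real.zero_rpow hα.ne'] at this
  refine (tendsto_inv_nhdsGT_zero.comp h0).congr fun n => ?_
  rw [Function.comp_apply, Real.rpow_neg (hpos n).le]

lemma measurableSet_renewalEvent (h : IsPoissonModel ℓ α C Y P) (k m : ℕ → ℕ) (p q : ℝ)
    {s : ℕ → Set UnitAddCircle} (hs : ∀ n, MeasurableSet (s n)) (n : ℕ) :
    MeasurableSet (renewalEvent C Y k m p q s n) :=
  (measurableSet_lt_and_lt (h.measurable_updateTime _ _) (h.measurable_updateTime _ _) p q).inter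
    (Finset.measurableSet_biUnion _ fun j _ => h.measurable_position n j (hs n))

lemma iIndepSet_renewalEvent (h : IsPoissonModel ℓ α C Y P) (k m : ℕ → ℕ) (p q : ℝ)
    {s : ℕ → Set UnitAddCircle} (hs : ∀ n, MeasurableSet (s n)) :
    iIndepSet (renewalEvent C Y k m p q s) P := by
  have hYr : ∀ n, Measurable fun ω j => Y n j ω := fun n =>
    measurable_pi_lambda _ (h.measurable_waiting n)
  have hCr : ∀ n, Measurable fun ω j => C n j ω := fun n =>
    measurable_pi_lambda _ (h.measurable_position n)
  have hind : IndepFun (fun ω n j => Y n j ω) (fun ω n j => C n j ω) P :=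
    (h.indep.comp (φ := Function.curry) (ψ := Function.curry)
      (measurable_pi_lambda _ fun i => measurable_pi_lambda _ fun j => measurable_pi_apply (i, j))
      (measurable_pi_lambda _ fun i => measurable_pi_lambda _ fun j =>
        measurable_pi_apply (i, j))).symm
  have key := iIndepSet_inter_preimage hYr hCr
    (iIndepFun_rows (fun p => h.measurable_waiting p.1 p.2) h.indep_waiting)
    (iIndepFun_rows (fun p => h.measurable_position p.1 p.2) h.indep_position) hind
    (s := fun n => {y : ℕ → ℝ | p < ∑ j ∈ Finset.range (k n), y j ∧
      ∑ j ∈ Finset.range (m n), y j < q})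
    (t := fun n => ⋃ j ∈ Finset.Ico (k n) (m n), {c : ℕ → UnitAddCircle | c j ∈ s n})
    (fun n => measurableSet_lt_and_lt (by fun_prop) (by fun_prop) p q)
    (fun n => Finset.measurableSet_biUnion _ fun j _ => measurable_pi_apply j (hs n))
  simp only [preimage_iUnion] at key
  exact key

lemma measureReal_renewalEvent (h : IsPoissonModel ℓ α C Y P) (k m : ℕ → ℕ) (p q : ℝ)
    {s : ℕ → Set UnitAddCircle} (hs : ∀ n, MeasurableSet (s n)) (n : ℕ) :
    P.real (renewalEvent C Y k m p q s n) =
      P.real {ω | p < updateTime Y n (k n) ω ∧ updateTime Y n (m n) ω < q} *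
        P.real (⋃ j ∈ Finset.Ico (k n) (m n), C n j ⁻¹' s n) := by
  have key := h.indep.symm.measure_inter_preimage_eq_mul
    {y : ℕ × ℕ → ℝ | p < ∑ j ∈ Finset.range (k n), y (n, j) ∧
      ∑ j ∈ Finset.range (m n), y (n, j) < q}
    (⋃ j ∈ Finset.Ico (k n) (m n), {c : ℕ × ℕ → UnitAddCircle | c (n, j) ∈ s n})
    (measurableSet_lt_and_lt (by fun_prop) (by fun_prop) p q)
    (Finset.measurableSet_biUnion _ fun j _ => measurable_pi_apply (n, j) (hs n))
  simp only [preimage_iUnion] at key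
  simp only [measureReal_def, ← ENNReal.toReal_mul]
  exact congrArg ENNReal.toReal key

/-- The block of indices aims at the middle third of `(p, p + 3 * δ)`, leaving a margin `δ` on each
side for Chebyshev. -/
lemma not_summable_measureReal_renewalEvent (h : IsPoissonModel ℓ α C Y P)
    (hpos : ∀ n, 0 < ℓ n) (hsum : Summable ℓ) (hα0 : 0 < α)
    (hα : ¬ Summable fun n => ℓ n ^ (1 - α)) (x : UnitAddCircle) {p δ : ℝ} (hp : 0 ≤ p)
    (hδ : 0 < δ) :
    ¬ Summable fun n => P.real (renewalEvent C Y (fun n => ⌈ℓ n ^ (-α) * (p + δ)⌉₊)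
      (fun n => ⌊ℓ n ^ (-α) * (p + 3 * δ - δ)⌋₊) p (p + 3 * δ)
      (fun n => Metric.ball x (ℓ n / 2)) n) := by
  intro hs
  have hrate := tendsto_rate_atTop hpos hsum hα0
  have hball : ∀ n, MeasurableSet (Metric.ball x (ℓ n / 2)) :=
    fun n => Metric.isOpen_ball.measurableSet
  set k : ℕ → ℕ := fun n => ⌈ℓ n ^ (-α) * (p + δ)⌉₊
  set m : ℕ → ℕ := fun n => ⌊ℓ n ^ (-α) * (p + 3 * δ - δ)⌋₊
  -- Rounding costs at most 2 indices out of `r * δ`, which is at most half once `r * δ ≥ 4`.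
  have hcount : ∀ᶠ n in atTop, ℓ n ^ (-α) * (δ / 2) ≤ (m n : ℝ) - k n := by
    filter_upwards [hrate.eventually_ge_atTop (4 / δ)] with n hn
    have hr := Real.rpow_pos_of_pos (hpos n) (-α)
    have hk : (k n : ℝ) < ℓ n ^ (-α) * (p + δ) + 1 := Nat.ceil_lt_add_one (by positivity)
    have hm : ℓ n ^ (-α) * (p + 3 * δ - δ) < m n + 1 := Nat.lt_floor_add_one _
    rw [div_le_iff₀ hδ] at hn
    linarith
  set f : ℕ → ℝ := fun n =>
    (Finset.Ico (k n) (m n)).card * volume.real (Metric.ball x (ℓ n / 2))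
  have hf : ∀ n, 0 ≤ f n := fun n => by positivity
  have hfsum : Summable f := by
    refine Summable.of_div_one_add hf
      (Summable.of_norm_bounded_eventually_nat (hs.mul_left 2) ?_)
    filter_upwards [hcount, hrate.eventually_ge_atTop (4 * (p + 3 * δ) / δ ^ 2)] with n hn hn'
    have hr := Real.rpow_pos_of_pos (hpos n) (-α)
    have hkm : k n ≤ m n := by
      have : (0 : ℝ) ≤ m n - k n := le_trans (by positivity) hn
      exact_mod_cast sub_nonneg.1 this
    have h1 : 1 / 2 ≤
        P.real {ω | p < updateTime Y n (k n) ω ∧ updateTime Y n (m n) ω < p + 3 * δ} :=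
      half_le_measureReal_lt_sum_and_sum_lt hr hδ (h.law_waiting n) (h.measurable_waiting n)
      (h.indep_waiting_row n) hkm (Nat.le_ceil _) (Nat.floor_le (mul_nonneg hr.le (by linarith)))
      ((div_le_iff₀ (by positivity)).1 hn')
    have h2 := div_one_add_le_measureReal_iUnion (h.measurable_position n) (h.law_position n)
      (h.indep_position_row n) (Finset.Ico (k n) (m n)) (hball n)
    change f n / (1 + f n) ≤ _ at h2
    have hfn := hf n
    rw [Real.norm_of_nonneg (by positivity), h.measureReal_renewalEvent k m p _ hball n]
    nlinarith [mul_le_mul h1 h2 (by positivity) (by linarith)]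
  refine hα (Summable.of_norm_bounded_eventually_nat (hfsum.mul_left (4 / δ)) ?_)
  filter_upwards [hcount, hsum.tendsto_atTop_zero.eventually (gt_mem_nhds zero_lt_one)]
    with n hn hn'
  have hr := Real.rpow_pos_of_pos (hpos n) (-α)
  have hl := hpos n
  have hb := min_le_measureReal_ball x (half_pos hl)
  rw [min_eq_right (by linarith)] at hb
  have hc : ((Finset.Ico (k n) (m n)).card : ℝ) ≥ ℓ n ^ (-α) * (δ / 2) := by
    rw [Nat.card_Ico]
    exact hn.trans (by rw [sub_le_iff_le_add]; exact_mod_cast le_tsub_add)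
  rw [Real.norm_of_nonneg (Real.rpow_nonneg hl.le _), sub_eq_add_neg, Real.rpow_add hl,
    Real.rpow_one]
  have hprod : ℓ n ^ (-α) * (δ / 2) * (ℓ n / 2) ≤ f n :=
    mul_le_mul hc hb (by positivity) (by positivity)
  calc ℓ n * ℓ n ^ (-α) = 4 / δ * (ℓ n ^ (-α) * (δ / 2) * (ℓ n / 2)) := by field_simp; norm_num
    _ ≤ 4 / δ * f n := by gcongr

theorem ae_coveringTimes_nonempty (h : IsPoissonModel ℓ α C Y P) (hpos : ∀ n, 0 < ℓ n)
    (hsum : Summable ℓ) (hα0 : 0 ≤ α) (hα : ¬ Summable fun n => ℓ n ^ (1 - α))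
    (x : UnitAddCircle) : ∀ᵐ ω ∂P, (coveringTimes ℓ (poissonCenter C Y) x ω).Nonempty := by
  -- For `α = 0` the series is that of `ℓ`, which converges.
  have hαpos : 0 < α := hα0.lt_of_ne' fun h0 => hα (by simpa [h0] using hsum)
  have hball : ∀ n, MeasurableSet (Metric.ball x (ℓ n / 2)) :=
    fun n => Metric.isOpen_ball.measurableSet
  have key : ∀ p q : ℚ, ∀ᵐ ω ∂P, 0 ≤ p → p < q → ∃ᶠ n in atTop,
      (interior {t | x ∈ arc (poissonCenter C Y n t ω) (ℓ n)} ∩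
        {t : ℝ≥0 | (p : ℝ) < t ∧ (t : ℝ) < q}).Nonempty := by
    intro p q
    by_cases hpq : 0 ≤ p ∧ p < q
    swap
    · exact ae_of_all _ fun ω h1 h2 => absurd ⟨h1, h2⟩ hpq
    have hp : (0 : ℝ) ≤ p := by exact_mod_cast hpq.1
    have hδ : (0 : ℝ) < ((q : ℝ) - p) / 3 := by
      have : (p : ℝ) < q := by exact_mod_cast hpq.2
      linarith
    have hq : (p : ℝ) + 3 * (((q : ℝ) - p) / 3) = q := by ring
    have hns := h.not_summable_measureReal_renewalEvent hpos hsum hαpos hα x hp hδ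
    rw [hq] at hns
    filter_upwards [h.ae_waiting_pos, ae_frequently_mem_of_not_summable
      (h.measurableSet_renewalEvent _ _ _ _ hball) (h.iIndepSet_renewalEvent _ _ _ _ hball) hns]
      with ω hY hω _ _
    exact hω.mono fun n hn => nonempty_interior_of_mem_renewalEvent (hY n) hn
  filter_upwards [ae_all_iff.2 fun p => ae_all_iff.2 (key p)] with ω hω
  exact coveringTimes_nonempty_of_frequently hω

end IsPoissonModel

end Poisson

end CircleCovering

theorem theorem1p7 {Ω : Type*} [MeasurableSpace Ω] (P : Measure Ω) [IsProbabilityMeasure P]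
    (ℓ : ℕ → ℝ) (hpos : ∀ n, 0 < ℓ n) (hanti : Antitone ℓ) (hsum : Summable ℓ)
    (x : UnitAddCircle) :
    (∀ U : ℕ → ℝ≥0 → Ω → UnitAddCircle, CircleCovering.IsBrownianModel U P →
      ∀ᵐ ω ∂P, (CircleCovering.coveringTimes ℓ U x ω).Nonempty) ∧
    (∀ α : ℝ, 0 ≤ α → ∀ (C : ℕ → ℕ → Ω → UnitAddCircle) (Y : ℕ → ℕ → Ω → ℝ),
      CircleCovering.IsPoissonModel ℓ α C Y P →
      (Summable (fun n => ℓ n ^ (1 - α)) →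
        ∀ᵐ ω ∂P,
          CircleCovering.coveringTimes ℓ (CircleCovering.poissonCenter C Y) x ω = ∅) ∧
      (¬ Summable (fun n => ℓ n ^ (1 - α)) →
        ∀ᵐ ω ∂P,
          (CircleCovering.coveringTimes ℓ (CircleCovering.poissonCenter C Y) x ω).Nonempty)) :=
  ⟨fun _ hU => hU.ae_coveringTimes_nonempty hpos x, fun _ hα _ _ h =>
    ⟨fun hs => h.ae_coveringTimes_eq_empty hpos hsum hs x,
      fun hs => h.ae_coveringTimes_nonempty hpos hsum hα hs x⟩⟩
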